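/- **Setting.** Let $D,N\ge 1$, let $\mathbf o_1,\dots,\mathbf o_N\in\mathbb R^D$ be the database and $\mathbf q\in\mathbb R^D$ the query. A *distance comparison operation* (DCO) on an object $\mathbf o$ with threshold $r\in[0,\infty]$ decides whether $dis=\|\mathbf o-\mathbf q\|\le r$ and, if so, returns $dis$; $\mathbf o$ is *positive* if $dis\le r$ and *negative* otherwise, and the distance gap of a negative object (for $r>0$) is $\alpha=(dis-r)/r$. The cost of a DCO is the number of dimensions it processes. $\texttt{FDScanning}$ computes $dis$ from all $D$ dimensions (cost $D$). $\texttt{ADSampling}$ with parameter $\epsilon_0\ge 0$ works on $\mathbf y=P\mathbf o-P\mathbf q$, where $P$ is one Haar-distributed random orthogonal $D\times D$ matrix used for all objects and the query: for $d=1,2,\dots,D-1$ it samples the coordinate $y_d$, forms $dis'=\sqrt{D/d}\,\|(y_1,\dots,y_d)\|$, and stops with answer "no" if $dis'>(1+\epsilon_0/\sqrt d)\,r$; if it reaches $d=D$, then $dis'=dis$ and it answers exactly. Its cost is the number $\hat D$ of sampled coordinates. An AKNN algorithm $\texttt{AKNN}$ performs other computations and DCOs, each depending on the answers of the previous DCOs,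 and returns a result; it may use randomness of its own and, apart from its DCOs, may work on the raw or on the transformed vectors. In $\texttt{AKNN}$ all DCOs are done by $\texttt{FDScanning}$; replacing it by $\texttt{ADSampling}$ gives $\texttt{AKNN+}$. **Statement.** There are absolute constants $c_0,C>0$ such that for all $D,N\ge1$ and $\delta'\in(0,1]$, with $\epsilon_0=\sqrt{c_0^{-1}\log(DN/\delta')}$, for every database, query and AKNN algorithm: 1. The probability that $\texttt{AKNN+}$ fails to return the same result as $\texttt{AKNN}$ is at most $\delta'$. 2. For every object and threshold $0<r<dis$, with $\alpha=(dis-r)/r$, $$\mathbb E[\hat D]\le C\,\min\Bigl(D,\ \max\Bigl(1,\ \frac1{\alpha^2}\log\frac{DN}{\delta'}\Bigr)\Bigr).$$ The same bound holds for the DCOs made during the run of $\texttt{AKNN+}$, whose thresholds may be random: for every object and every $\alpha>0$ there is a random variable $X$ with $\mathbb E[X]$ at most the right-hand side such that every DCO made on this object with a positive threshold, for which it is negative with distance gap at least $\alpha$, costs at most $X$. 3. All remaining costs are unchanged: outside an event of probability at most $\delta'$, the runs of $\texttt{AKNN+}$ and $\texttt{AKNN}$ have the same cost of other computations and make the same DCOs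 with the same answers, and each DCO on a positive object has the same cost in both. In every case no DCO of $\texttt{AKNN+}$ costs more than $D$. -/

import Mathlib

open MeasureTheory ProbabilityTheory
open scoped ENNReal

/-! ### Random orthogonal matrices -/

/-- The group `O(D)` of real orthogonal `D × D` matrices. -/
abbrev OrthMat (D : ℕ) : Type := ↥(Matrix.orthogonalGroup (Fin D) ℝ)

/-- `O(D)` carries its Borel σ-algebra (for the usual topology on matrices). -/
instance OrthMat.instMeasurableSpace (D : ℕ) : MeasurableSpace (OrthMat D) := borel _

instance OrthMat.instBorelSpace (D : ℕ) : BorelSpace (OrthMat D) := ⟨rfl⟩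

instance OrthMat.instCompactSpace (D : ℕ) : CompactSpace (OrthMat D) := by
  have hK : IsCompact (Set.pi Set.univ fun _ : Fin D =>
      Set.pi Set.univ fun _ : Fin D => Set.Icc (-1 : ℝ) 1) :=
    isCompact_univ_pi fun _ => isCompact_univ_pi fun _ => isCompact_Icc
  have hcl : IsClosed ((Matrix.orthogonalGroup (Fin D) ℝ : Submonoid (Matrix (Fin D) (Fin D) ℝ)) :
      Set (Matrix (Fin D) (Fin D) ℝ)) := isClosed_unitary
  refine isCompact_iff_compactSpace.mp (IsCompact.of_isClosed_subset hK hcl ?_)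
  intro U hU i _ j _
  have h := entry_norm_bound_of_unitary (𝕜 := ℝ) hU i j
  rw [Real.norm_eq_abs] at h
  exact abs_le.mp h

/-- The law of a random orthogonal matrix (a uniformly random rotation / reflection): the Haar
measure of the compact group `O(D)`, normalised to total mass `1`. -/
noncomputable def randomOrthogonal (D : ℕ) : Measure (OrthMat D) :=
  Measure.haarMeasure (⊤ : TopologicalSpace.PositiveCompacts (OrthMat D))

instance randomOrthogonal.instIsProbabilityMeasure (D : ℕ) :
    IsProbabilityMeasure (randomOrthogonal D) :=
  ⟨by
    have h := Measure.haarMeasure_self (K₀ := (⊤ : TopologicalSpace.PositiveCompacts (OrthMat D)))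
    simpa [randomOrthogonal] using h⟩

/-- The transformed vector `P v`. -/
noncomputable def transformed {D : ℕ} (P : OrthMat D) (v : EuclideanSpace ℝ (Fin D)) :
    EuclideanSpace ℝ (Fin D) :=
  Matrix.toEuclideanLin (P : Matrix (Fin D) (Fin D) ℝ) v

/-! ### Distance comparison operations

A procedure for the distance comparison operation (DCO) returns a pair.  The first component is the
answer: `some dis` for "yes, the distance is at most `r`, and it is `dis`", and `none` for "no".
The second component is the cost: the number of dimensions (coordinates) it has processed.
Thresholds lie in `[0, ∞]`, since algorithms use the threshold `+∞` while their result set is not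
yet full. -/

/-- `FDScanning`: compute the distance from all `D` dimensions and compare it with `r`. -/
noncomputable def fdScanning {D : ℕ} (o q : EuclideanSpace ℝ (Fin D)) (r : ℝ≥0∞) :
    Option ℝ × ℕ :=
  (if ENNReal.ofReal (dist o q) ≤ r then some (dist o q) else none, D)

/-- The loop of `ADSampling` on a (transformed) object `o` and (transformed) query `q`, entered
with `d` dimensions sampled so far and `s = ∑_{i < d} (o i - q i) ^ 2`.  A round samples one more
dimension, which makes the approximate distance `dis' = √(D / d) * ‖(o - q)|_{[1, …, d]}‖` for the
new `d`, and tests the null hypothesis `dis ≤ r`, which is rejected iff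
`dis' > (1 + ε₀ / √d) * r`. -/
noncomputable def adLoop {D : ℕ} (ε₀ : ℝ) (o q : EuclideanSpace ℝ (Fin D)) (r : ℝ≥0∞)
    (d : ℕ) (s : ℝ) : Option ℝ × ℕ :=
  open Classical in
  if h : d < D then
    let s' : ℝ := s + (o ⟨d, h⟩ - q ⟨d, h⟩) ^ 2
    let dis' : ℝ := √((D : ℝ) / ((d + 1 : ℕ) : ℝ)) * √s'
    if d + 1 < D then
      if ENNReal.ofReal (1 + ε₀ / √((d + 1 : ℕ) : ℝ)) * r < ENNReal.ofReal dis' then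
        (none, d + 1)
      else
        adLoop ε₀ o q r (d + 1) s'
    else
      (if ENNReal.ofReal dis' ≤ r then some dis' else none, d + 1)
  else
    (none, d)
termination_by D - d

/-- `ADSampling` with parameter `ε₀`, on a transformed object and a transformed query. -/
noncomputable def adSampling {D : ℕ} (ε₀ : ℝ) (o q : EuclideanSpace ℝ (Fin D)) (r : ℝ≥0∞) :
    Option ℝ × ℕ :=
  adLoop ε₀ o q r 0 0

/-- The distance gap `α = (dis - r) / r`. -/
noncomputable def distanceGap (dis r : ℝ) : ℝ := (dis - r) / r

/-- The parameter `ε₀` with `D * exp (-c₀ * ε₀ ^ 2) = δ' / N`. -/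
noncomputable def epsilonParam (c₀ : ℝ) (D N : ℕ) (δ' : ℝ) : ℝ :=
  √(Real.log ((D : ℝ) * N / δ') / c₀)

/-- `min (D, max (1, α⁻² log (D N / δ')))`. -/
noncomputable def costBound (D N : ℕ) (δ' α : ℝ) : ℝ :=
  min (D : ℝ) (max 1 ((α ^ 2)⁻¹ * Real.log ((D : ℝ) * N / δ')))

/-! ### AKNN algorithms -/

/-- The query phase of an AKNN algorithm on a database of `N` objects, for a given database, index
and query, with its DCOs left as calls: it either returns a result, or performs one elementary
step of other computation and goes on, or calls a DCO on an object with a threshold and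
goes on depending on the answer. -/
inductive AKNNProgram (N : ℕ) (R : Type*) where
  | ret (result : R) : AKNNProgram N R
  | step (next : AKNNProgram N R) : AKNNProgram N R
  | dco (obj : Fin N) (threshold : ℝ≥0∞) (next : Option ℝ → AKNNProgram N R) : AKNNProgram N R

/-- What a run records about one DCO. -/
structure DCORecord (N : ℕ) where
  obj : Fin N
  threshold : ℝ≥0∞
  answer : Option ℝ
  cost : ℕ

/-- A completed run: its result, the number of elementary steps outside the DCOs, and its DCOs
in order. -/
structure Execution (N : ℕ) (R : Type*) where
  result : R
  otherCost : ℕ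
  dcos : List (DCORecord N)

/-- Run an AKNN algorithm with a given procedure for the DCOs. -/
def AKNNProgram.run {N : ℕ} {R : Type*} (proc : Fin N → ℝ≥0∞ → Option ℝ × ℕ) :
    AKNNProgram N R → Execution N R
  | .ret a => ⟨a, 0, []⟩
  | .step p =>
      let e := AKNNProgram.run proc p
      ⟨e.result, e.otherCost + 1, e.dcos⟩
  | .dco i r k =>
      let z := proc i r
      let e := AKNNProgram.run proc (k z.1)
      ⟨e.result, e.otherCost, ⟨i, r, z.1, z.2⟩ :: e.dcos⟩

/-- `AKNN`: the DCOs are done by `FDScanning`. -/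
noncomputable def aknnRun {D N : ℕ} {R : Type*} (O : Fin N → EuclideanSpace ℝ (Fin D))
    (q : EuclideanSpace ℝ (Fin D)) (A : AKNNProgram N R) : Execution N R :=
  A.run fun i r => fdScanning (O i) q r

/-- `AKNN+`: the DCOs are done by `ADSampling` on the vectors transformed by `P`. -/
noncomputable def aknnPlusRun {D N : ℕ} {R : Type*} (ε₀ : ℝ) (P : OrthMat D)
    (O : Fin N → EuclideanSpace ℝ (Fin D)) (q : EuclideanSpace ℝ (Fin D))
    (A : AKNNProgram N R) : Execution N R :=
  A.run fun i r => adSampling ε₀ (transformed P (O i)) (transformed P q) r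

/-- Two runs agree in everything but the cost of DCOs on negative objects: same result, same
cost outside the DCOs, and the same DCOs in the same order with the same answers, where a DCO on a
positive object (distance at most the threshold) has the same cost in both. -/
def AgreeExceptNegativeCost {D N : ℕ} {R : Type*} (O : Fin N → EuclideanSpace ℝ (Fin D))
    (q : EuclideanSpace ℝ (Fin D)) (e e' : Execution N R) : Prop :=
  e.result = e'.result ∧ e.otherCost = e'.otherCost ∧
    List.Forall₂ (fun a b : DCORecord N =>
      a.obj = b.obj ∧ a.threshold = b.threshold ∧ a.answer = b.answer ∧
        (ENNReal.ofReal (dist (O a.obj) q) ≤ a.threshold → a.cost = b.cost)) e.dcos e'.dcos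

/-! ### The action of random orthogonal matrices on vectors -/

/-! Fix `v = o - q`. The law of `P v` depends only on `‖v‖`, so the probability that `P v` lies in a
cone is at most the cone's standard Gaussian measure (`randomOrthogonal_le_stdGaussian`). Comparing
`D * headSq d x` with `β * d * ‖x‖ ^ 2` is a homogeneous diagonal quadratic condition. Chernoff's
bound for independent Gaussians therefore controls both tails of the projected norm, with exponent
`d / 2 * (log β + 1 - β)` (`randomOrthogonal_headSq_deviation`). For `β = (1 ± u) ^ 2` this is at
most `-d * u ^ 2 / 2`, as in the Johnson–Lindenstrauss lemma.

Correctness: a negative object is never answered wrongly, since an early stop says "no" and the last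
round is exact. An error on a positive object forces some `dis' > (1 + ε₀ / √k) * dis`, which has
probability at most `exp (-ε₀ ^ 2 / 2) = δ' / (D * N)` for `c₀ = 1 / 2`; a union bound runs over `N`
objects and `D - 1` rounds. This bad event involves only `P`, neither the thresholds nor the
algorithm. Off it the two runs agree by induction, however the calls depend on earlier answers or on
`P`.

Cost: once `k ≥ 4 * ε₀ ^ 2 / α ^ 2`, the tolerance is at most `α / 2`, and surviving round `k`
requires `dis'` to fall below `dis` by a fixed factor. The resulting geometric series contributes
`O(1 + α⁻²)` rounds. Cost is monotone in the threshold, so random thresholds with gap at least `α`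
are dominated by the deterministic threshold `dis / (1 + α)`. -/

instance OrthMat.instSecondCountableTopology (D : ℕ) : SecondCountableTopology (OrthMat D) :=
  haveI : SecondCountableTopology (Matrix (Fin D) (Fin D) ℝ) :=
    inferInstanceAs (SecondCountableTopology (Fin D → Fin D → ℝ))
  inferInstanceAs (SecondCountableTopology
    ((Matrix.orthogonalGroup (Fin D) ℝ : Set (Matrix (Fin D) (Fin D) ℝ))))

instance randomOrthogonal.instIsHaarMeasure (D : ℕ) : (randomOrthogonal D).IsHaarMeasure := by
  unfold randomOrthogonal
  infer_instance

/-- Right translation turns the left-invariant measure into another Haar probability measure, and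
such a measure is unique. -/
theorem randomOrthogonal_map_mul_right {D : ℕ} (Q : OrthMat D) :
    (randomOrthogonal D).map (· * Q) = randomOrthogonal D := by
  have : IsProbabilityMeasure ((randomOrthogonal D).map (· * Q)) :=
    Measure.isProbabilityMeasure_map (by fun_prop)
  exact Measure.isHaarMeasure_eq_of_isProbabilityMeasure _ _

section transformed

variable {D : ℕ}

theorem transformed_apply (P : OrthMat D) (v : EuclideanSpace ℝ (Fin D)) (i : Fin D) :
    transformed P v i = ∑ j, P.1 i j * v j := by
  simp [transformed, Matrix.mulVec, dotProduct]

theorem transformed_mul (P Q : OrthMat D) (v : EuclideanSpace ℝ (Fin D)) :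
    transformed (P * Q) v = transformed P (transformed Q v) := by
  simp [transformed, Matrix.toLpLin_apply]

theorem transformed_sub (P : OrthMat D) (v w : EuclideanSpace ℝ (Fin D)) :
    transformed P (v - w) = transformed P v - transformed P w := by
  simp [transformed]

theorem transformed_smul (P : OrthMat D) (c : ℝ) (v : EuclideanSpace ℝ (Fin D)) :
    transformed P (c • v) = c • transformed P v := by
  simp [transformed]

theorem transformed_zero (P : OrthMat D) : transformed P 0 = 0 := by
  simp [transformed]

theorem norm_transformed (P : OrthMat D) (v : EuclideanSpace ℝ (Fin D)) :
    ‖transformed P v‖ = ‖v‖ := by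
  have h : ‖transformed P v‖ ^ 2 = ‖v‖ ^ 2 := by
    have hP : (P.1).transpose * P.1 = 1 := by
      have h := P.2.1
      rwa [Matrix.star_eq_conjTranspose, Matrix.conjTranspose_eq_transpose_of_trivial] at h
    rw [← real_inner_self_eq_norm_sq, ← real_inner_self_eq_norm_sq, transformed,
      ← LinearMap.adjoint_inner_left, ← Matrix.toEuclideanLin_conjTranspose_eq_adjoint]
    congr 1
    simp [Matrix.toLpLin_apply, hP]
  exact (sq_eq_sq₀ (norm_nonneg _) (norm_nonneg _)).mp h

/-- The transformation by an orthogonal matrix, as a linear isometric equivalence. -/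
noncomputable def transformedEquiv (P : OrthMat D) :
    EuclideanSpace ℝ (Fin D) ≃ₗᵢ[ℝ] EuclideanSpace ℝ (Fin D) :=
  LinearIsometry.toLinearIsometryEquiv
    ⟨Matrix.toEuclideanLin (P : Matrix (Fin D) (Fin D) ℝ), norm_transformed P⟩ rfl

theorem coe_transformedEquiv (P : OrthMat D) : ⇑(transformedEquiv P) = transformed P := rfl

theorem exists_transformed_eq_linearIsometryEquiv
    (R : EuclideanSpace ℝ (Fin D) ≃ₗᵢ[ℝ] EuclideanSpace ℝ (Fin D)) :
    ∃ Q : OrthMat D, ∀ v, transformed Q v = R v := by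
  let b := EuclideanSpace.basisFun (Fin D) ℝ
  refine ⟨⟨b.toBasis.toMatrix (b.map R).toBasis,
    b.toMatrix_orthonormalBasis_mem_orthogonal (b.map R)⟩, fun v => ?_⟩
  have hv : R v = ∑ j, v j • R (b j) := by
    conv_lhs => rw [← b.sum_repr v]
    simp [b]
  ext i
  rw [transformed_apply, hv]
  simp [Module.Basis.toMatrix_apply, b, mul_comm]

/-- The reflection in the hyperplane orthogonal to `v - w` exchanges two vectors of equal norm. -/
theorem exists_transformed_eq {v w : EuclideanSpace ℝ (Fin D)} (h : ‖v‖ = ‖w‖) :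
    ∃ Q : OrthMat D, transformed Q v = w := by
  obtain ⟨Q, hQ⟩ :=
    exists_transformed_eq_linearIsometryEquiv (Submodule.reflection (Submodule.span ℝ {v - w})ᗮ)
  exact ⟨Q, by rw [hQ, Submodule.reflection_sub h]⟩

theorem continuous_transformed :
    Continuous fun z : OrthMat D × EuclideanSpace ℝ (Fin D) => transformed z.1 z.2 := by
  have h1 (i j : Fin D) : Continuous fun z : OrthMat D × EuclideanSpace ℝ (Fin D) => z.1.1 i j :=
    (continuous_subtype_val.comp continuous_fst).matrix_elem i j
  have h3 (j : Fin D) : Continuous fun z : OrthMat D × EuclideanSpace ℝ (Fin D) => z.2 j :=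
    (EuclideanSpace.proj (𝕜 := ℝ) j).continuous.comp continuous_snd
  have h2 : Continuous fun z : OrthMat D × EuclideanSpace ℝ (Fin D) =>
      (WithLp.toLp 2 fun i => ∑ j, z.1.1 i j * z.2 j : EuclideanSpace ℝ (Fin D)) :=
    (PiLp.continuous_toLp 2 _).comp (continuous_pi fun i =>
      continuous_finsetSum _ fun j _ => (h1 i j).mul (h3 j))
  refine h2.congr fun z => ?_
  ext i
  exact (transformed_apply z.1 z.2 i).symm

theorem measurable_transformed (v : EuclideanSpace ℝ (Fin D)) :
    Measurable fun P : OrthMat D => transformed P v :=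
  (continuous_transformed.comp (Continuous.prodMk continuous_id continuous_const)).measurable

/-- The law of `P v` depends only on the norm of `v`. -/
theorem randomOrthogonal_transformed_eq_of_norm_eq {v w : EuclideanSpace ℝ (Fin D)}
    (h : ‖v‖ = ‖w‖) {S : Set (EuclideanSpace ℝ (Fin D))} (hS : MeasurableSet S) :
    randomOrthogonal D {P | transformed P v ∈ S} =
      randomOrthogonal D {P | transformed P w ∈ S} := by
  obtain ⟨Q, rfl⟩ := exists_transformed_eq h
  have hm : MeasurableSet {P : OrthMat D | transformed P v ∈ S} := measurable_transformed v hS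
  have hmap := Measure.map_apply (μ := randomOrthogonal D) (measurable_mul_const Q) hm
  rw [randomOrthogonal_map_mul_right] at hmap
  rw [hmap]
  congr 1
  ext P
  simp [transformed_mul]

/-- A random direction falls into a cone (which contains the origin) with at most the probability
that a standard Gaussian vector does. -/
theorem randomOrthogonal_le_stdGaussian {v : EuclideanSpace ℝ (Fin D)} (hv : v ≠ 0)
    {S : Set (EuclideanSpace ℝ (Fin D))} (hS : MeasurableSet S)
    (hcone : ∀ c : ℝ, 0 < c → ∀ x ∈ S, c • x ∈ S) (h0 : (0 : EuclideanSpace ℝ (Fin D)) ∈ S) :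
    randomOrthogonal D {P | transformed P v ∈ S} ≤
      stdGaussian (EuclideanSpace ℝ (Fin D)) S := by
  set γ := stdGaussian (EuclideanSpace ℝ (Fin D))
  -- For fixed `P`, the Gaussian is invariant under the isometry `P`.
  have hconst (P : OrthMat D) : γ {g | transformed P g ∈ S} = γ S := by
    have h := stdGaussian_map (transformedEquiv P)
    rw [coe_transformedEquiv] at h
    conv_rhs => rw [show γ = γ.map (transformed P) from h.symm]
    rw [Measure.map_apply _ hS]
    · rfl
    · rw [← coe_transformedEquiv]
      exact (transformedEquiv P).continuous.measurable
  have hle (g : EuclideanSpace ℝ (Fin D)) :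
      randomOrthogonal D {P | transformed P v ∈ S} ≤
        randomOrthogonal D {P | transformed P g ∈ S} := by
    -- Since `0 ∈ S`, the comparison holds at `g = 0` too, so no null set has to be removed.
    by_cases hg : g = 0
    · subst hg
      have : {P : OrthMat D | transformed P 0 ∈ S} = Set.univ := by
        ext P
        simp [transformed_zero, h0]
      rw [this]
      exact measure_mono (Set.subset_univ _)
    · have hg' : 0 < ‖g‖ := norm_pos_iff.mpr hg
      have hv' : 0 < ‖v‖ := norm_pos_iff.mpr hv
      have hn : ‖(‖g‖ / ‖v‖) • v‖ = ‖g‖ := by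
        rw [norm_smul, Real.norm_eq_abs, abs_of_pos (by positivity)]
        field_simp
      rw [← randomOrthogonal_transformed_eq_of_norm_eq hn hS]
      refine measure_mono fun P hP => ?_
      simp only [Set.mem_ofPred_eq, transformed_smul] at hP ⊢
      exact hcone _ (by positivity) _ hP
  have hmeas : MeasurableSet {z : OrthMat D × EuclideanSpace ℝ (Fin D) |
      transformed z.1 z.2 ∈ S} := continuous_transformed.measurable hS
  -- Average over a Gaussian `g` independent of `P`, then exchange the integrals.
  calc randomOrthogonal D {P | transformed P v ∈ S}
      = ∫⁻ _, randomOrthogonal D {P | transformed P v ∈ S} ∂γ := by simp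
    _ ≤ ∫⁻ g, randomOrthogonal D {P | transformed P g ∈ S} ∂γ := lintegral_mono hle
    _ = ((randomOrthogonal D).prod γ) {z | transformed z.1 z.2 ∈ S} :=
        (Measure.prod_apply_symm hmeas).symm
    _ = ∫⁻ P, γ {g | transformed P g ∈ S} ∂randomOrthogonal D := Measure.prod_apply hmeas
    _ = γ S := by simp [hconst]

end transformed

/-! ### Tail bounds for quadratic forms in Gaussian variables -/

theorem exp_mul_sq_gaussianPDF (c x : ℝ) :
    gaussianPDFReal 0 1 x * Real.exp (c * x ^ 2) =
      (√(2 * Real.pi))⁻¹ * Real.exp (-(1 / 2 - c) * x ^ 2) := by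
  rw [gaussianPDFReal, mul_assoc, ← Real.exp_add]
  simp only [NNReal.coe_one, mul_one]
  congr 2
  ring

theorem integrable_exp_mul_sq_gaussianReal {c : ℝ} (hc : c < 1 / 2) :
    Integrable (fun x : ℝ => Real.exp (c * x ^ 2)) (gaussianReal 0 1) := by
  rw [gaussianReal_of_var_ne_zero _ one_ne_zero, gaussianPDF_def,
    integrable_withDensity_iff_integrable_smul₀']
  · simp only [ENNReal.toReal_ofReal (gaussianPDFReal_nonneg 0 1 _), smul_eq_mul,
      exp_mul_sq_gaussianPDF]
    exact (integrable_exp_neg_mul_sq (by linarith)).const_mul _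
  · exact (measurable_gaussianPDFReal 0 1).ennreal_ofReal.aemeasurable
  · simp

/-- The value is `(1 - 2 * c) ^ (-1 / 2)`, written as an exponential so that a product over
coordinates becomes a sum of exponents. -/
theorem integral_exp_mul_sq_gaussianReal {c : ℝ} (hc : c < 1 / 2) :
    ∫ x : ℝ, Real.exp (c * x ^ 2) ∂gaussianReal 0 1 = Real.exp (-Real.log (1 - 2 * c) / 2) := by
  rw [integral_gaussianReal_eq_integral_smul one_ne_zero]
  simp only [smul_eq_mul, exp_mul_sq_gaussianPDF]
  rw [integral_const_mul, integral_gaussian, ← Real.sqrt_inv, ← Real.sqrt_mul (by positivity),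
    neg_div, ← neg_div, ← Real.log_inv, Real.exp_half, Real.exp_log (by simp; linarith)]
  congr 1
  have := Real.pi_ne_zero
  have : (1 - 2 * c) ≠ 0 := by linarith
  have : (1 / 2 - c) ≠ 0 := by linarith
  field_simp

/-- Chernoff's bound for a diagonal quadratic form in independent standard Gaussian variables. -/
theorem stdGaussian_quadratic_nonneg_le {D : ℕ} {c : Fin D → ℝ} (hc : ∀ i, c i < 1 / 2) :
    (stdGaussian (EuclideanSpace ℝ (Fin D))).real {x | 0 ≤ ∑ i, c i * x i ^ 2} ≤
      Real.exp (∑ i, -Real.log (1 - 2 * c i) / 2) := by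
  have hexp (x : EuclideanSpace ℝ (Fin D)) :
      Real.exp (1 * ∑ i, c i * x i ^ 2) = ∏ i, Real.exp (c i * x i ^ 2) := by
    rw [one_mul, Real.exp_sum]
  have hmeas : Measurable (WithLp.toLp 2 : (Fin D → ℝ) → EuclideanSpace ℝ (Fin D)) := by fun_prop
  have hcont : AEStronglyMeasurable (fun x : EuclideanSpace ℝ (Fin D) =>
      ∏ i, Real.exp (c i * x i ^ 2)) (stdGaussian (EuclideanSpace ℝ (Fin D))) :=
    Continuous.aestronglyMeasurable (by fun_prop)
  have hint : Integrable (fun x : EuclideanSpace ℝ (Fin D) => Real.exp (1 * ∑ i, c i * x i ^ 2))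
      (stdGaussian (EuclideanSpace ℝ (Fin D))) := by
    simp only [hexp]
    rw [← map_pi_eq_stdGaussian] at hcont ⊢
    rw [integrable_map_measure hcont hmeas.aemeasurable]
    exact Integrable.fintype_prod fun i => integrable_exp_mul_sq_gaussianReal (hc i)
  -- The Chernoff parameter is `1`, since any rescaling can be absorbed into `c`.
  refine (measure_ge_le_exp_mul_mgf 0 zero_le_one hint).trans_eq ?_
  rw [mul_zero, Real.exp_zero, one_mul, mgf]
  simp only [hexp]
  rw [← map_pi_eq_stdGaussian] at hcont ⊢
  rw [integral_map hmeas.aemeasurable hcont]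
  refine (integral_fintype_prod_eq_prod (fun i (x : ℝ) => Real.exp (c i * x ^ 2))).trans ?_
  rw [Real.exp_sum]
  exact Finset.prod_congr rfl fun i _ => integral_exp_mul_sq_gaussianReal (hc i)

/-! ### Concentration of the norm of a random projection -/

/-- The squared norm of the first `d` coordinates. -/
noncomputable def headSq {D : ℕ} (d : ℕ) (x : EuclideanSpace ℝ (Fin D)) : ℝ :=
  ∑ i : Fin D, if i.val < d then x i ^ 2 else 0

theorem sum_fin_lt_ite {D d : ℕ} (hd : d ≤ D) (a b : ℝ) :
    ∑ i : Fin D, (if i.val < d then a else b) = d * a + (D - d) * b := by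
  rw [Fin.sum_univ_eq_sum_range (fun i => if i < d then a else b) D,
    ← Finset.sum_range_add_sum_Ico _ hd]
  rw [Finset.sum_congr rfl (g := fun _ => a) fun i hi => if_pos (Finset.mem_range.mp hi),
    Finset.sum_congr rfl (g := fun _ => b)
      fun i hi => if_neg (not_lt.mpr (Finset.mem_Ico.mp hi).1)]
  simp [Nat.cast_sub hd]

/-- Both tails of the squared norm of the projection of a random direction to the first `d`
coordinates, for a deviation by the factor `β`: the upper tail for `1 < β`, the lower one for
`β < 1`. -/
theorem randomOrthogonal_headSq_deviation {D d : ℕ} (hd : 0 < d) (hdD : d < D) {β : ℝ}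
    (hβ : 0 < β) (hβd : β * d < D) {v : EuclideanSpace ℝ (Fin D)} (hv : v ≠ 0) :
    (randomOrthogonal D).real {P | 0 ≤ (1 - β⁻¹) *
        (D * headSq d (transformed P v) - β * d * ‖transformed P v‖ ^ 2)} ≤
      Real.exp (d / 2 * (Real.log β + 1 - β)) := by
  have hd' : (0 : ℝ) < d := by exact_mod_cast hd
  have hdD' : (d : ℝ) < D := by exact_mod_cast hdD
  have hw : 0 < (D : ℝ) - β * d := by linarith
  -- This is the stationary point of the Chernoff exponent; it makes `1 - 2 * c i = β⁻¹` on the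
  -- first `d` coordinates. Its sign is that of `β - 1`, which selects the tail.
  set t : ℝ := (1 - β⁻¹) / (2 * (D - β * d)) with ht
  set c : Fin D → ℝ := fun i => if i.val < d then t * (D - β * d) else -(t * (β * d)) with hc
  have htc : t * (D - β * d) = (1 - β⁻¹) / 2 := by rw [ht]; field_simp
  have htail : 1 + 2 * (t * (β * d)) = (D - d) / (D - β * d) := by
    rw [ht]; field_simp; ring
  have hform (x : EuclideanSpace ℝ (Fin D)) :
      ∑ i, c i * x i ^ 2 = t * (D * headSq d x - β * d * ‖x‖ ^ 2) := by
    rw [EuclideanSpace.real_norm_sq_eq, headSq, Finset.mul_sum, Finset.mul_sum,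
      ← Finset.sum_sub_distrib, Finset.mul_sum]
    refine Finset.sum_congr rfl fun i _ => ?_
    simp only [hc]
    split_ifs <;> ring
  have hset : {x : EuclideanSpace ℝ (Fin D) | 0 ≤ (1 - β⁻¹) *
      (D * headSq d x - β * d * ‖x‖ ^ 2)} = {x | 0 ≤ ∑ i, c i * x i ^ 2} := by
    ext x
    rw [Set.mem_ofPred_eq, Set.mem_ofPred_eq, hform, ht, div_mul_eq_mul_div,
      le_div_iff₀ (by positivity), zero_mul]
  have hchalf (i : Fin D) : c i < 1 / 2 := by
    simp only [hc]
    split_ifs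
    · rw [htc]
      have := inv_pos.mpr hβ
      linarith
    · have : 0 < 1 + 2 * (t * (β * d)) := by
        rw [htail]
        exact div_pos (by linarith) hw
      linarith
  have hmeas : Measurable fun x : EuclideanSpace ℝ (Fin D) => ∑ i, c i * x i ^ 2 :=
    Continuous.measurable (by fun_prop)
  have hle := randomOrthogonal_le_stdGaussian hv
    (S := {x | 0 ≤ ∑ i, c i * x i ^ 2}) (measurableSet_le measurable_const hmeas)
    (fun a ha x hx => by
      have : ∑ i, c i * (a • x) i ^ 2 = a ^ 2 * ∑ i, c i * x i ^ 2 := by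
        rw [Finset.mul_sum]
        refine Finset.sum_congr rfl fun i _ => ?_
        simp only [PiLp.smul_apply, smul_eq_mul]
        ring
      simp only [Set.mem_ofPred_eq] at hx ⊢
      rw [this]
      positivity)
    (by simp)
  rw [← hset] at hle
  refine (ENNReal.toReal_mono (measure_ne_top _ _) hle).trans ?_
  rw [hset]
  refine (stdGaussian_quadratic_nonneg_le hchalf).trans (Real.exp_le_exp.mpr ?_)
  have hlog (i : Fin D) : -Real.log (1 - 2 * c i) / 2 =
      if i.val < d then Real.log β / 2 else -Real.log ((D - d) / (D - β * d)) / 2 := by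
    simp only [hc]
    split_ifs
    · rw [htc, show 1 - 2 * ((1 - β⁻¹) / 2) = β⁻¹ by ring, Real.log_inv, neg_neg]
    · rw [← htail]
      congr 3
      ring
  rw [Finset.sum_congr rfl fun i _ => hlog i, sum_fin_lt_ite hdD.le]
  -- The bound `1 - w⁻¹ ≤ log w` replaces the contribution of the last `D - d` coordinates by `(1 -
  -- β) * d / 2`, which is free of `D`.
  have h1 := Real.one_sub_inv_le_log_of_pos (div_pos (sub_pos.mpr hdD') hw)
  rw [inv_div] at h1
  have h2 : ((D : ℝ) - d) * (1 - (D - β * d) / (D - d)) = (β - 1) * d := by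
    have : (D : ℝ) - d ≠ 0 := by linarith
    field_simp
    ring
  have h3 := mul_le_mul_of_nonneg_left h1 (sub_pos.mpr hdD').le
  rw [h2] at h3
  linarith

/-! ### The loop of `ADSampling` -/

theorem headSq_zero {D : ℕ} (x : EuclideanSpace ℝ (Fin D)) : headSq 0 x = 0 := by
  simp [headSq]

theorem headSq_nonneg {D : ℕ} (d : ℕ) (x : EuclideanSpace ℝ (Fin D)) : 0 ≤ headSq d x :=
  Finset.sum_nonneg fun i _ => by split_ifs <;> positivity

theorem headSq_self {D : ℕ} (x : EuclideanSpace ℝ (Fin D)) : headSq D x = ‖x‖ ^ 2 := by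
  simp [headSq, EuclideanSpace.real_norm_sq_eq]

theorem headSq_succ {D d : ℕ} (hd : d < D) (x : EuclideanSpace ℝ (Fin D)) :
    headSq (d + 1) x = headSq d x + x ⟨d, hd⟩ ^ 2 := by
  have h (i : Fin D) : (if i.val < d + 1 then x i ^ 2 else 0) =
      (if i.val < d then x i ^ 2 else 0) + if i = ⟨d, hd⟩ then x i ^ 2 else 0 := by
    by_cases hi : i = ⟨d, hd⟩
    · subst hi
      simp
    · have hi' : i.val ≠ d := fun h => hi (Fin.ext h)
      have : i.val < d + 1 ↔ i.val < d := by omega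
      simp [hi, this]
  simp only [headSq, h, Finset.sum_add_distrib]
  simp

theorem headSq_le {D : ℕ} (d : ℕ) (x : EuclideanSpace ℝ (Fin D)) : headSq d x ≤ ‖x‖ ^ 2 := by
  rw [← headSq_self]
  refine Finset.sum_le_sum fun i _ => ?_
  simp only [i.isLt, if_true]
  split_ifs
  · exact le_rfl
  · positivity

theorem continuous_headSq {D : ℕ} (d : ℕ) :
    Continuous (headSq d : EuclideanSpace ℝ (Fin D) → ℝ) := by
  unfold headSq
  refine continuous_finsetSum _ fun i _ => ?_
  split_ifs <;> fun_prop

/-- The approximate distance `dis'` computed from the first `d` coordinates of the difference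
vector `x`. -/
noncomputable def approxDist {D : ℕ} (d : ℕ) (x : EuclideanSpace ℝ (Fin D)) : ℝ :=
  √((D : ℝ) / (d : ℝ)) * √(headSq d x)

theorem approxDist_self {D : ℕ} (hD : 0 < D) (x : EuclideanSpace ℝ (Fin D)) :
    approxDist D x = ‖x‖ := by
  have : (D : ℝ) ≠ 0 := by positivity
  rw [approxDist, headSq_self, div_self this, Real.sqrt_one, one_mul,
    Real.sqrt_sq (norm_nonneg _)]

theorem approxDist_nonneg {D : ℕ} (d : ℕ) (x : EuclideanSpace ℝ (Fin D)) : 0 ≤ approxDist d x := by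
  unfold approxDist
  positivity

theorem approxDist_sq {D : ℕ} (d : ℕ) (x : EuclideanSpace ℝ (Fin D)) :
    approxDist d x ^ 2 = D / d * headSq d x := by
  rw [approxDist, mul_pow, Real.sq_sqrt (by positivity), Real.sq_sqrt (headSq_nonneg d x)]

theorem measurable_approxDist {D : ℕ} (d : ℕ) :
    Measurable (approxDist d : EuclideanSpace ℝ (Fin D) → ℝ) :=
  (continuous_const.mul (continuous_headSq d).sqrt).measurable

/-- The hypothesis that the distance is at most `r` is rejected after `d` coordinates of the
difference vector `x`. -/
def Rejects {D : ℕ} (ε₀ : ℝ) (r : ℝ≥0∞) (d : ℕ) (x : EuclideanSpace ℝ (Fin D)) : Prop :=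
  ENNReal.ofReal (1 + ε₀ / √(d : ℝ)) * r < ENNReal.ofReal (approxDist d x)

theorem Rejects.mono {D d : ℕ} {ε₀ : ℝ} {r r' : ℝ≥0∞} {x : EuclideanSpace ℝ (Fin D)}
    (h : Rejects ε₀ r' d x) (hr : r ≤ r') : Rejects ε₀ r d x :=
  (mul_le_mul_right hr _).trans_lt h

theorem measurableSet_rejects {D : ℕ} (ε₀ : ℝ) (r : ℝ≥0∞) (d : ℕ) :
    MeasurableSet {x : EuclideanSpace ℝ (Fin D) | Rejects ε₀ r d x} :=
  measurableSet_lt measurable_const (measurable_approxDist d).ennreal_ofReal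

section adLoop

variable {D : ℕ} {ε₀ : ℝ} {o q : EuclideanSpace ℝ (Fin D)} {r : ℝ≥0∞}

open Classical in
-- The accumulator stays equal to `headSq d (o - q)`. In the last round the scaling factor is `1`
-- and `dis'` is the exact distance, so the outcome is that of `fdScanning`, including the cost `D`.
theorem adLoop_headSq {d : ℕ} (hd : d < D) :
    adLoop ε₀ o q r d (headSq d (o - q)) =
      if d + 1 < D then
        if Rejects ε₀ r (d + 1) (o - q) then (none, d + 1)
        else adLoop ε₀ o q r (d + 1) (headSq (d + 1) (o - q))
      else fdScanning o q r := by
  rw [adLoop, dif_pos hd]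
  have hs : headSq d (o - q) + (o ⟨d, hd⟩ - q ⟨d, hd⟩) ^ 2 = headSq (d + 1) (o - q) := by
    rw [headSq_succ hd]
    rfl
  have ha : √((D : ℝ) / ((d + 1 : ℕ) : ℝ)) * √(headSq (d + 1) (o - q)) =
      approxDist (d + 1) (o - q) := rfl
  simp only [hs, ha]
  by_cases h1 : d + 1 < D
  · rw [if_pos h1, if_pos h1]
    by_cases h2 : Rejects ε₀ r (d + 1) (o - q)
    · rw [if_pos h2]
      exact if_pos h2
    · rw [if_neg h2]
      exact if_neg h2
  · rw [if_neg h1, if_neg h1]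
    obtain rfl : D = d + 1 := by omega
    simp only [approxDist_self (Nat.succ_pos d), ← dist_eq_norm, fdScanning]

/-- Induction along the rounds of `ADSampling`. -/
theorem adLoop_induction {p : ℕ → Prop} (last : ∀ d, d + 1 = D → p d)
    (round : ∀ d, d + 1 < D → p (d + 1) → p d) : ∀ d, d < D → p d := by
  intro d hd
  induction h : D - d generalizing d with
  | zero => omega
  | succ n ih =>
    by_cases hd' : d + 1 < D
    · exact round d hd' (ih (d + 1) hd' (by omega))
    · exact last d (by omega)

theorem adLoop_cost_le {d : ℕ} (hd : d < D) :
    (adLoop ε₀ o q r d (headSq d (o - q))).2 ≤ D := by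
  refine adLoop_induction (p := fun d => (adLoop ε₀ o q r d (headSq d (o - q))).2 ≤ D)
    (fun d h => ?_) (fun d h ih => ?_) d hd
  · rw [adLoop_headSq (by omega), if_neg (by omega)]
    simp [fdScanning]
  · rw [adLoop_headSq (by omega), if_pos h]
    split_ifs
    · exact h.le
    · exact ih

/-- The second conjunct feeds the induction: if only the smaller threshold rejects at a round, the
other loop still has to sample at least one more coordinate. -/
theorem adLoop_cost_mono {r' : ℝ≥0∞} (hr : r ≤ r') {d : ℕ} (hd : d < D) :
    (adLoop ε₀ o q r d (headSq d (o - q))).2 ≤ (adLoop ε₀ o q r' d (headSq d (o - q))).2 ∧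
      d + 1 ≤ (adLoop ε₀ o q r' d (headSq d (o - q))).2 := by
  refine adLoop_induction (p := fun d => (adLoop ε₀ o q r d (headSq d (o - q))).2 ≤
      (adLoop ε₀ o q r' d (headSq d (o - q))).2 ∧
      d + 1 ≤ (adLoop ε₀ o q r' d (headSq d (o - q))).2)
    (fun d h => ?_) (fun d h ih => ?_) d hd
  · have hd' : d < D := by omega
    rw [adLoop_headSq (r := r) hd', adLoop_headSq (r := r') hd', if_neg (by omega),
      if_neg (by omega)]
    simp [fdScanning, h]
  · have hd' : d < D := by omega
    rw [adLoop_headSq (r := r) hd', adLoop_headSq (r := r') hd', if_pos h, if_pos h]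
    by_cases h' : Rejects ε₀ r' (d + 1) (o - q)
    · simp [h', h'.mono hr]
    · simp only [h', if_false]
      refine ⟨?_, by omega⟩
      split_ifs
      · exact (Nat.le_succ _).trans ih.2
      · exact ih.1

theorem adLoop_eq_fdScanning {d : ℕ} (hd : d < D)
    (hr : ∀ k, d < k → k < D → ¬ Rejects ε₀ r k (o - q)) :
    adLoop ε₀ o q r d (headSq d (o - q)) = fdScanning o q r := by
  refine adLoop_induction (p := fun d => (∀ k, d < k → k < D → ¬ Rejects ε₀ r k (o - q)) →
    adLoop ε₀ o q r d (headSq d (o - q)) = fdScanning o q r)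
    (fun d h _ => ?_) (fun d h ih hk => ?_) d hd hr
  · rw [adLoop_headSq (by omega), if_neg (by omega)]
  · rw [adLoop_headSq (by omega), if_pos h, if_neg (hk _ (Nat.lt_succ_self d) h)]
    exact ih fun k h1 h2 => hk k (by omega) h2

/-- Early stops answer `none` and the last round is exact, so errors are one-sided whatever the
rotation. -/
theorem adLoop_answer_of_negative (hr : r < ENNReal.ofReal (dist o q)) {d : ℕ} (hd : d < D) :
    (adLoop ε₀ o q r d (headSq d (o - q))).1 = none := by
  refine adLoop_induction (p := fun d => (adLoop ε₀ o q r d (headSq d (o - q))).1 = none)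
    (fun d h => ?_) (fun d h ih => ?_) d hd
  · rw [adLoop_headSq (by omega), if_neg (by omega)]
    simp only [fdScanning, if_neg (not_le.mpr hr)]
  · rw [adLoop_headSq (by omega), if_pos h]
    split_ifs
    · rfl
    · exact ih

theorem adLoop_cost_le_of_rejects {d k : ℕ} (hd : d < D) (hdk : d < k) (hk : k < D)
    (hr : Rejects ε₀ r k (o - q)) : (adLoop ε₀ o q r d (headSq d (o - q))).2 ≤ k := by
  refine adLoop_induction (p := fun d => d < k → (adLoop ε₀ o q r d (headSq d (o - q))).2 ≤ k)
    (fun d h hdk => by omega) (fun d h ih hdk => ?_) d hd hdk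
  rw [adLoop_headSq (by omega), if_pos h]
  split_ifs with hrd
  · exact hdk
  · refine ih (lt_of_le_of_ne hdk ?_)
    rintro rfl
    exact hrd hr

theorem measurable_adLoop_cost {α : Type*} [MeasurableSpace α]
    {o q : α → EuclideanSpace ℝ (Fin D)} (ho : Measurable o) (hq : Measurable q) {d : ℕ}
    (hd : d < D) :
    Measurable fun a => (adLoop ε₀ (o a) (q a) r d (headSq d (o a - q a))).2 := by
  classical
  refine adLoop_induction (p := fun d =>
    Measurable fun a => (adLoop ε₀ (o a) (q a) r d (headSq d (o a - q a))).2)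
    (fun d h => ?_) (fun d h ih => ?_) d hd
  · simp only [adLoop_headSq (show d < D by omega), if_neg (show ¬ d + 1 < D by omega), fdScanning]
    exact measurable_const
  · simp only [adLoop_headSq (show d < D by omega), if_pos h, apply_ite Prod.snd]
    exact Measurable.ite ((ho.sub hq) (measurableSet_rejects ε₀ r (d + 1))) measurable_const ih

end adLoop

section adSampling

variable {D : ℕ} {ε₀ : ℝ} {o q : EuclideanSpace ℝ (Fin D)} {r : ℝ≥0∞}

theorem adSampling_eq_adLoop :
    adSampling ε₀ o q r = adLoop ε₀ o q r 0 (headSq 0 (o - q)) := by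
  rw [adSampling, headSq_zero]

theorem adSampling_cost_le (hD : 0 < D) : (adSampling ε₀ o q r).2 ≤ D := by
  rw [adSampling_eq_adLoop]
  exact adLoop_cost_le hD

theorem adSampling_cost_mono (hD : 0 < D) {r' : ℝ≥0∞} (hr : r ≤ r') :
    (adSampling ε₀ o q r).2 ≤ (adSampling ε₀ o q r').2 := by
  rw [adSampling_eq_adLoop, adSampling_eq_adLoop]
  exact (adLoop_cost_mono hr hD).1

theorem adSampling_answer_of_negative (hD : 0 < D) (hr : r < ENNReal.ofReal (dist o q)) :
    (adSampling ε₀ o q r).1 = none := by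
  rw [adSampling_eq_adLoop]
  exact adLoop_answer_of_negative hr hD

theorem adSampling_eq_fdScanning (hD : 0 < D)
    (hr : ∀ k, 0 < k → k < D → ¬ Rejects ε₀ r k (o - q)) :
    adSampling ε₀ o q r = fdScanning o q r := by
  rw [adSampling_eq_adLoop]
  exact adLoop_eq_fdScanning hD hr

/-- If no approximate distance exceeds the distance by more than the tolerance of the test, then
`ADSampling` is exact, and on positive objects it is `FDScanning`. -/
theorem adSampling_of_approxDist_le (hD : 0 < D) (hε : 0 ≤ ε₀)
    (h : ∀ k, 0 < k → k < D → approxDist k (o - q) ≤ (1 + ε₀ / √(k : ℝ)) * dist o q)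
    (r : ℝ≥0∞) :
    (adSampling ε₀ o q r).1 = (fdScanning o q r).1 ∧
      (ENNReal.ofReal (dist o q) ≤ r → adSampling ε₀ o q r = fdScanning o q r) := by
  have hpos : ENNReal.ofReal (dist o q) ≤ r → adSampling ε₀ o q r = fdScanning o q r := by
    refine fun hr => adSampling_eq_fdScanning hD fun k hk hkD hrej => hrej.not_ge ?_
    calc ENNReal.ofReal (approxDist k (o - q))
        ≤ ENNReal.ofReal ((1 + ε₀ / √(k : ℝ)) * dist o q) := ENNReal.ofReal_le_ofReal (h k hk hkD)
      _ = ENNReal.ofReal (1 + ε₀ / √(k : ℝ)) * ENNReal.ofReal (dist o q) :=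
        ENNReal.ofReal_mul (by positivity)
      _ ≤ _ := mul_le_mul_right hr _
  refine ⟨?_, hpos⟩
  by_cases hr : ENNReal.ofReal (dist o q) ≤ r
  · rw [hpos hr]
  · rw [adSampling_answer_of_negative hD (not_le.mp hr)]
    simp [fdScanning, hr]

/-- The cost of `ADSampling` is at most `m` plus the number of the later rounds that do not
reject. -/
theorem adSampling_cost_le_sum (hD : 0 < D) {m : ℕ} (hm : 0 < m) :
    ((adSampling ε₀ o q r).2 : ℝ) ≤
      m + ∑ k ∈ Finset.Ico m D, {x | ¬ Rejects ε₀ r k x}.indicator 1 (o - q) := by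
  set c := (adSampling ε₀ o q r).2 with hc
  have hcD : c ≤ D := adSampling_cost_le hD
  have hnonneg (k : ℕ) : (0 : ℝ) ≤ {x | ¬ Rejects ε₀ r k x}.indicator 1 (o - q) :=
    Set.indicator_nonneg (fun _ _ => zero_le_one) _
  rcases le_total c m with h | h
  · have h1 : (c : ℝ) ≤ m := by exact_mod_cast h
    exact h1.trans (le_add_of_nonneg_right (Finset.sum_nonneg fun k _ => hnonneg k))
  -- A rejection at a round `k < c` would have stopped the loop by then, so each of these `c - m`
  -- indicators is `1`.
  have hone : ∀ k ∈ Finset.Ico m c,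
      (1 : ℝ) ≤ {x | ¬ Rejects ε₀ r k x}.indicator 1 (o - q) := by
    intro k hk
    rw [Finset.mem_Ico] at hk
    rw [Set.indicator_of_mem]
    · simp
    · intro hrej
      have := adLoop_cost_le_of_rejects hD (show 0 < k by omega) (by omega) hrej
      rw [← adSampling_eq_adLoop, ← hc] at this
      omega
  calc (c : ℝ) = m + ∑ k ∈ Finset.Ico m c, (1 : ℝ) := by simp [Nat.cast_sub h]
    _ ≤ m + ∑ k ∈ Finset.Ico m c, {x | ¬ Rejects ε₀ r k x}.indicator 1 (o - q) :=
      add_le_add_right (Finset.sum_le_sum hone) _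
    _ ≤ _ := add_le_add_right (Finset.sum_le_sum_of_subset_of_nonneg
      (Finset.Ico_subset_Ico_right hcD) fun k _ _ => hnonneg k) _

theorem measurable_adSampling_cost (hD : 0 < D) (ε₀ : ℝ) (r : ℝ≥0∞)
    (o q : EuclideanSpace ℝ (Fin D)) :
    Measurable fun P : OrthMat D => (adSampling ε₀ (transformed P o) (transformed P q) r).2 := by
  simp only [adSampling_eq_adLoop]
  exact measurable_adLoop_cost (measurable_transformed o) (measurable_transformed q) hD

end adSampling

/-! ### Error probability and expected cost of `ADSampling` -/

section tails

variable {D k : ℕ} {v : EuclideanSpace ℝ (Fin D)}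

/-- The approximate distance of a random rotation rarely exceeds the true distance by much. -/
theorem randomOrthogonal_approxDist_gt_le (hk : 0 < k) (hkD : k < D) {ε₀ : ℝ} (hε : 0 ≤ ε₀) :
    (randomOrthogonal D).real
        {P | (1 + ε₀ / √(k : ℝ)) * ‖v‖ < approxDist k (transformed P v)} ≤
      Real.exp (-ε₀ ^ 2 / 2) := by
  have hk' : (0 : ℝ) < k := by exact_mod_cast hk
  have hD' : (0 : ℝ) < D := by exact_mod_cast hk.trans hkD
  set u : ℝ := ε₀ / √(k : ℝ) with hu
  have hu0 : 0 ≤ u := by positivity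
  have hku : k * u ^ 2 = ε₀ ^ 2 := by
    rw [hu, div_pow, Real.sq_sqrt hk'.le]
    field_simp
  have hsq {P : OrthMat D} (hP : (1 + u) * ‖v‖ < approxDist k (transformed P v)) :
      (1 + u) ^ 2 * k * ‖transformed P v‖ ^ 2 < D * headSq k (transformed P v) := by
    have h1 := pow_lt_pow_left₀ hP (by positivity) two_ne_zero
    rw [approxDist_sq, mul_pow, div_mul_eq_mul_div, lt_div_iff₀ hk'] at h1
    rw [norm_transformed]
    linarith
  by_cases hβ : (1 + u) ^ 2 * k < D ∧ v ≠ 0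
  · refine le_trans ?_ ((randomOrthogonal_headSq_deviation hk hkD (β := (1 + u) ^ 2)
      (by positivity) hβ.1 hβ.2).trans (Real.exp_le_exp.mpr ?_))
    · refine measureReal_mono fun P hP => ?_
      have h1 : ((1 + u) ^ 2)⁻¹ ≤ 1 := inv_le_one_of_one_le₀ (by nlinarith)
      exact Set.mem_ofPred.mpr (mul_nonneg (by linarith) (by linarith [hsq hP]))
    -- From `log (1 + u) ≤ u` one gets `2 * log (1 + u) + 1 - (1 + u) ^ 2 ≤ -u ^ 2`, and `k * u ^ 2
    -- = ε₀ ^ 2`.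
    · have h1 := Real.log_le_sub_one_of_pos (show 0 < 1 + u by positivity)
      rw [Real.log_pow]
      push_cast
      nlinarith
  -- Outside the range of the deviation bound the event is impossible, because `headSq k x ≤ ‖x‖ ^
  -- 2`.
  · have : {P | (1 + u) * ‖v‖ < approxDist k (transformed P v)} = ∅ := by
      refine Set.eq_empty_of_forall_notMem fun P hP => ?_
      have h1 := hsq hP
      have h2 := headSq_le k (transformed P v)
      have h3 := headSq_nonneg k (transformed P v)
      rcases not_and_or.mp hβ with h | h
      · have h4 := mul_le_mul_of_nonneg_right (not_lt.mp h) (sq_nonneg ‖transformed P v‖)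
        have h5 := mul_le_mul_of_nonneg_left h2 hD'.le
        linarith
      · rw [not_not.mp h, transformed_zero] at h1
        simp [headSq] at h1
    rw [this, measureReal_empty]
    positivity

/-- The approximate distance of a random rotation is rarely much less than the true distance. -/
theorem randomOrthogonal_approxDist_le_le (hk : 0 < k) (hkD : k < D) (hv : v ≠ 0) {u : ℝ}
    (hu : 0 < u) (hu1 : u < 1) :
    (randomOrthogonal D).real {P | approxDist k (transformed P v) ≤ (1 - u) * ‖v‖} ≤
      Real.exp (-(u ^ 2 / 2)) ^ k := by
  have hk' : (0 : ℝ) < k := by exact_mod_cast hk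
  have hkD' : (k : ℝ) < D := by exact_mod_cast hkD
  have hpos : 0 < (1 - u) ^ 2 := by
    have : 0 < 1 - u := by linarith
    positivity
  have hle1 : (1 - u) ^ 2 ≤ 1 := by nlinarith
  rw [← Real.exp_nat_mul]
  refine le_trans ?_ ((randomOrthogonal_headSq_deviation hk hkD (β := (1 - u) ^ 2) hpos
    (by nlinarith) hv).trans (Real.exp_le_exp.mpr ?_))
  · refine measureReal_mono fun P hP => ?_
    have h1 := pow_le_pow_left₀ (approxDist_nonneg _ _) hP 2
    rw [approxDist_sq, mul_pow, div_mul_eq_mul_div, div_le_iff₀ hk',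
      ← norm_transformed P v] at h1
    have h2 : 1 ≤ ((1 - u) ^ 2)⁻¹ := (one_le_inv₀ hpos).mpr hle1
    exact Set.mem_ofPred.mpr (mul_nonneg_of_nonpos_of_nonpos (by linarith) (by linarith))
  · have h1 := Real.log_le_sub_one_of_pos (show 0 < 1 - u by linarith)
    rw [Real.log_pow]
    push_cast
    nlinarith

end tails

/-- For `0 < x ≤ 1`, `exp (-x) ≤ 1 / (1 + x) ≤ 1 - x / 2`, so the ratio of the geometric series is
at least `x / 2` below `1`. -/
theorem sum_exp_neg_pow_le {x : ℝ} (hx : 0 < x) (hx1 : x ≤ 1) (n : ℕ) :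
    ∑ k ∈ Finset.range n, Real.exp (-x) ^ k ≤ 2 / x := by
  have h1 : Real.exp (-x) ≤ 1 - x / 2 := by
    have h2 : Real.exp (-x) * (1 + x) ≤ 1 := by
      have h3 : Real.exp (-x) * Real.exp x = 1 := by rw [← Real.exp_add]; simp
      have h4 := Real.add_one_le_exp x
      nlinarith [Real.exp_pos (-x)]
    nlinarith
  have h5 := mul_neg_geom_sum (Real.exp (-x)) n
  have h6 : 0 < Real.exp (-x) ^ n := by positivity
  have h7 : 0 ≤ ∑ k ∈ Finset.range n, Real.exp (-x) ^ k := Finset.sum_nonneg fun k _ => by positivity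
  rw [le_div_iff₀ hx]
  nlinarith

section cost

variable {D : ℕ}

theorem integrable_adSampling_cost (hD : 0 < D) (ε₀ : ℝ) (r : ℝ≥0∞)
    (o q : EuclideanSpace ℝ (Fin D)) :
    Integrable (fun P => ((adSampling ε₀ (transformed P o) (transformed P q) r).2 : ℝ))
      (randomOrthogonal D) := by
  refine Integrable.of_bound
    (measurable_from_top.comp (measurable_adSampling_cost hD ε₀ r o q)).aestronglyMeasurable
    (D : ℝ) (Filter.Eventually.of_forall fun P => ?_)
  rw [Real.norm_of_nonneg (Nat.cast_nonneg _)]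
  exact_mod_cast adSampling_cost_le hD

/-- The expected cost in terms of the number of rounds `m` after which the test becomes reliable. -/
theorem integral_adSampling_cost_le (hD : 0 < D) {ε₀ r α : ℝ} (hr : 0 < r) (hα : 0 < α)
    (hε : 0 ≤ ε₀) {o q : EuclideanSpace ℝ (Fin D)} (hdist : dist o q = (1 + α) * r) {m : ℕ}
    (hm : 0 < m) (hm' : 4 * ε₀ ^ 2 / α ^ 2 ≤ m) :
    ∫ P, ((adSampling ε₀ (transformed P o) (transformed P q) (ENNReal.ofReal r)).2 : ℝ)
      ∂randomOrthogonal D ≤ m + (32 + 32 / α ^ 2) := by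
  set v := o - q with hv
  have hvnorm : ‖v‖ = (1 + α) * r := by rw [← hdist, dist_eq_norm]
  have hv0 : v ≠ 0 := norm_pos_iff.mp (by rw [hvnorm]; positivity)
  -- Chosen so that `(1 - u) * (1 + α) = 1 + α / 2`: half of the gap goes to the tolerance of the
  -- test, half to the deviation.
  set u : ℝ := α / (2 * (1 + α)) with hu
  have hu0 : 0 < u := by positivity
  have hu1 : u < 1 := by
    rw [hu, div_lt_one (by positivity)]
    linarith
  have hmeas (k : ℕ) : MeasurableSet
      {P : OrthMat D | ¬ Rejects ε₀ (ENNReal.ofReal r) k (transformed P v)} :=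
    measurable_transformed v (measurableSet_rejects ε₀ (ENNReal.ofReal r) k).compl
  have hprob : ∀ k ∈ Finset.Ico m D, (randomOrthogonal D).real
      {P | ¬ Rejects ε₀ (ENNReal.ofReal r) k (transformed P v)} ≤ Real.exp (-(u ^ 2 / 2)) ^ k := by
    intro k hk
    rw [Finset.mem_Ico] at hk
    have hk' : (0 : ℝ) < k := by exact_mod_cast hm.trans_le hk.1
    refine le_trans (measureReal_mono fun P hP => ?_)
      (randomOrthogonal_approxDist_le_le (hm.trans_le hk.1) hk.2 hv0 hu0 hu1)
    have hnot := not_lt.mp hP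
    rw [← ENNReal.ofReal_mul (by positivity), ENNReal.ofReal_le_ofReal_iff (by positivity)] at hnot
    have hεk : ε₀ / √(k : ℝ) ≤ α / 2 := by
      have h1 : 4 * ε₀ ^ 2 / α ^ 2 ≤ k := hm'.trans (by exact_mod_cast hk.1)
      rw [div_le_iff₀ (by positivity)] at h1
      refine abs_le_of_sq_le_sq' ?_ (by positivity) |>.2
      rw [div_pow, Real.sq_sqrt hk'.le, div_le_iff₀ hk']
      linarith
    refine Set.mem_ofPred.mpr (hnot.trans ?_)
    have h2 : (1 - u) * ‖v‖ = (1 + α / 2) * r := by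
      rw [hvnorm, hu]
      field_simp
      ring
    rw [h2]
    gcongr
  have hrw (P : OrthMat D) (k : ℕ) : {x | ¬ Rejects ε₀ (ENNReal.ofReal r) k x}.indicator
      (1 : EuclideanSpace ℝ (Fin D) → ℝ) (transformed P o - transformed P q) =
      {P : OrthMat D | ¬ Rejects ε₀ (ENNReal.ofReal r) k (transformed P v)}.indicator 1 P := by
    rw [← transformed_sub]
    rfl
  have hsum : ∑ k ∈ Finset.Ico m D, Real.exp (-(u ^ 2 / 2)) ^ k ≤ 32 + 32 / α ^ 2 := by
    have h1 : ∑ k ∈ Finset.Ico m D, Real.exp (-(u ^ 2 / 2)) ^ k ≤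
        ∑ k ∈ Finset.range D, Real.exp (-(u ^ 2 / 2)) ^ k := by
      rw [Finset.range_eq_Ico]
      exact Finset.sum_le_sum_of_subset_of_nonneg (Finset.Ico_subset_Ico_left (Nat.zero_le m))
        fun k _ _ => by positivity
    refine (h1.trans (sum_exp_neg_pow_le (by positivity) (by nlinarith) D)).trans ?_
    -- The constant `32` comes from `(1 + α) ^ 2 ≤ 2 * (1 + α ^ 2)`.
    have h2 : 2 / (u ^ 2 / 2) = 16 * (1 + α) ^ 2 / α ^ 2 := by
      rw [hu]
      field_simp
      ring
    have h3 : 32 + 32 / α ^ 2 = (32 * α ^ 2 + 32) / α ^ 2 := by field_simp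
    rw [h2, h3]
    gcongr
    nlinarith [sq_nonneg (α - 1)]
  have hint (k : ℕ) : Integrable ({P : OrthMat D |
      ¬ Rejects ε₀ (ENNReal.ofReal r) k (transformed P v)}.indicator (1 : OrthMat D → ℝ))
      (randomOrthogonal D) := (integrable_const 1).indicator (hmeas k)
  have hint' := integrable_finsetSum (Finset.Ico m D) fun k _ => hint k
  calc _ ≤ ∫ P, ((m : ℝ) + ∑ k ∈ Finset.Ico m D, {P : OrthMat D |
          ¬ Rejects ε₀ (ENNReal.ofReal r) k (transformed P v)}.indicator 1 P)
          ∂randomOrthogonal D := by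
        refine integral_mono (integrable_adSampling_cost hD ε₀ _ o q)
          ((integrable_const _).add hint') fun P => ?_
        refine (adSampling_cost_le_sum hD hm).trans_eq ?_
        simp only [hrw]
    _ = m + ∑ k ∈ Finset.Ico m D, (randomOrthogonal D).real
          {P | ¬ Rejects ε₀ (ENNReal.ofReal r) k (transformed P v)} := by
        rw [integral_add (integrable_const _) hint', integral_finsetSum _ fun k _ => hint k]
        simp [integral_indicator_one, hmeas]
    _ ≤ m + ∑ k ∈ Finset.Ico m D, Real.exp (-(u ^ 2 / 2)) ^ k :=
        add_le_add_right (Finset.sum_le_sum hprob) _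
    _ ≤ _ := add_le_add_right hsum _

theorem epsilonParam_half_sq {D N : ℕ} {δ' : ℝ} (hL : 0 ≤ Real.log ((D : ℝ) * N / δ')) :
    epsilonParam (1 / 2) D N δ' ^ 2 = 2 * Real.log ((D : ℝ) * N / δ') := by
  rw [epsilonParam, Real.sq_sqrt (by positivity)]
  ring

/-- This makes the logarithm nonnegative, and at least `log 2` as soon as `D ≥ 2`. -/
theorem le_div_of_pos_of_le_one {D N : ℕ} {δ' : ℝ} (hN : 0 < N) (hδ : 0 < δ')
    (hδ1 : δ' ≤ 1) : (D : ℝ) ≤ (D : ℝ) * N / δ' := by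
  have hN' : (1 : ℝ) ≤ N := by exact_mod_cast hN
  have hD' : (0 : ℝ) ≤ D := Nat.cast_nonneg D
  rw [le_div_iff₀ hδ]
  calc (D : ℝ) * δ' ≤ D * 1 := by gcongr
    _ ≤ D * N := by gcongr

theorem costBound_nonneg (D N : ℕ) (δ' α : ℝ) : 0 ≤ costBound D N δ' α :=
  le_min (Nat.cast_nonneg D) (zero_le_one.trans (le_max_left _ _))

theorem integral_adSampling_cost_le_costBound {N : ℕ} {δ' : ℝ} (hD : 0 < D) (hN : 0 < N)
    (hδ : 0 < δ') (hδ1 : δ' ≤ 1) {r α : ℝ} (hr : 0 < r) (hα : 0 < α)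
    {o q : EuclideanSpace ℝ (Fin D)} (hdist : dist o q = (1 + α) * r) :
    ∫ P, ((adSampling (epsilonParam (1 / 2) D N δ') (transformed P o) (transformed P q)
      (ENNReal.ofReal r)).2 : ℝ) ∂randomOrthogonal D ≤ 100 * costBound D N δ' α := by
  set ε₀ := epsilonParam (1 / 2) D N δ' with hε₀
  set L := Real.log ((D : ℝ) * N / δ') with hL
  have hle := le_div_of_pos_of_le_one (D := D) hN hδ hδ1
  have hDpos : (0 : ℝ) < D := by exact_mod_cast hD
  have hD1 : (1 : ℝ) ≤ D := by exact_mod_cast hD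
  have hL0 : 0 ≤ L := Real.log_nonneg (hD1.trans hle)
  have hcostD : ∫ P, ((adSampling ε₀ (transformed P o) (transformed P q)
      (ENNReal.ofReal r)).2 : ℝ) ∂randomOrthogonal D ≤ D := by
    have h := integral_mono (integrable_adSampling_cost hD ε₀ (ENNReal.ofReal r) o q)
      (integrable_const (D : ℝ)) fun P => by
        show ((adSampling ε₀ (transformed P o) (transformed P q) (ENNReal.ofReal r)).2 : ℝ) ≤ D
        exact_mod_cast adSampling_cost_le hD
    simpa using h
  set M := max 1 ((α ^ 2)⁻¹ * L) with hM
  have hM1 : 1 ≤ M := le_max_left _ _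
  have hML : (α ^ 2)⁻¹ * L ≤ M := le_max_right _ _
  have hcostM : ∫ P, ((adSampling ε₀ (transformed P o) (transformed P q)
      (ENNReal.ofReal r)).2 : ℝ) ∂randomOrthogonal D ≤ 100 * M := by
    -- For `D = 1` the logarithm may vanish, but the cost is at most `1 ≤ M`. For `D ≥ 2` its lower
    -- bound `2 / 3` lets `α⁻²` be absorbed into `M`.
    by_cases hD2 : D = 1
    · have : (D : ℝ) = 1 := by exact_mod_cast hD2
      linarith
    have hlog2 : 2 / 3 ≤ L := by
      have h2D : (2 : ℝ) ≤ D := by exact_mod_cast (show 2 ≤ D by omega)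
      have h1 := Real.log_le_log two_pos (h2D.trans hle)
      linarith [Real.log_two_gt_d9]
    have hα2 : (α ^ 2)⁻¹ ≤ 3 / 2 * M := by
      have h1 : (α ^ 2)⁻¹ * (2 / 3) ≤ (α ^ 2)⁻¹ * L := by gcongr
      linarith
    -- Here `8 = 4 * 2` because `ε₀ ^ 2 = 2 * L`, and the `+ 1` keeps `m` positive. The total is at
    -- most `8 * M + 2 + 32 + 48 * M ≤ 90 * M`.
    set m := ⌈8 * ((α ^ 2)⁻¹ * L)⌉₊ + 1 with hm
    have hmle : (m : ℝ) ≤ 8 * ((α ^ 2)⁻¹ * L) + 2 := by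
      have := Nat.ceil_lt_add_one (show 0 ≤ 8 * ((α ^ 2)⁻¹ * L) by positivity)
      rw [hm]
      push_cast
      linarith
    have hmge : 4 * ε₀ ^ 2 / α ^ 2 ≤ m := by
      have := Nat.le_ceil (8 * ((α ^ 2)⁻¹ * L))
      rw [hε₀, epsilonParam_half_sq hL0, ← hL, hm]
      push_cast
      calc 4 * (2 * L) / α ^ 2 = 8 * ((α ^ 2)⁻¹ * L) := by ring
        _ ≤ _ := by linarith
    have hε : 0 ≤ ε₀ := Real.sqrt_nonneg _
    have hmpos : 0 < m := Nat.succ_pos _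
    have h := integral_adSampling_cost_le hD hr hα hε hdist hmpos hmge
    rw [div_eq_mul_inv] at h
    linarith
  rw [costBound, ← hL, ← hM]
  rcases min_choice (D : ℝ) M with h | h <;> rw [h] <;> linarith

end cost

/-! ### Runs of AKNN algorithms -/

section runs

variable {N : ℕ} {R : Type*}

theorem AKNNProgram.cost_eq_of_mem_run {proc : Fin N → ℝ≥0∞ → Option ℝ × ℕ}
    (A : AKNNProgram N R) :
    ∀ e ∈ (A.run proc).dcos, e.cost = (proc e.obj e.threshold).2 := by
  induction A with
  | ret a => simp [AKNNProgram.run]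
  | step p ih => simpa [AKNNProgram.run] using ih
  | dco i r k ih =>
    intro e he
    rw [AKNNProgram.run, List.mem_cons] at he
    rcases he with rfl | he
    · rfl
    · exact ih _ e he

/-- Equal answers send both runs into the same continuation, so agreement propagates by induction on
the program. -/
theorem AKNNProgram.agreeExceptNegativeCost_run {D : ℕ} {O : Fin N → EuclideanSpace ℝ (Fin D)}
    {q : EuclideanSpace ℝ (Fin D)} {proc proc' : Fin N → ℝ≥0∞ → Option ℝ × ℕ}
    (h : ∀ i r, (proc i r).1 = (proc' i r).1 ∧
      (ENNReal.ofReal (dist (O i) q) ≤ r → proc i r = proc' i r))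
    (A : AKNNProgram N R) : AgreeExceptNegativeCost O q (A.run proc) (A.run proc') := by
  induction A with
  | ret a => exact ⟨rfl, rfl, List.Forall₂.nil⟩
  | step p ih => exact ⟨ih.1, congrArg (· + 1) ih.2.1, ih.2.2⟩
  | dco i r k ih =>
    have ih' := ih (proc i r).1
    simp only [AKNNProgram.run]
    rw [← (h i r).1]
    exact ⟨ih'.1, ih'.2.1, List.Forall₂.cons
      ⟨rfl, rfl, rfl, fun hr => congrArg Prod.snd ((h i r).2 hr)⟩ ih'.2.2⟩

/-- The event that some approximate distance is too large for `ADSampling` to be reliable. -/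
def badRotations {D : ℕ} (ε₀ : ℝ) (O : Fin N → EuclideanSpace ℝ (Fin D))
    (q : EuclideanSpace ℝ (Fin D)) : Set (OrthMat D) :=
  ⋃ i : Fin N, ⋃ k ∈ Finset.Ico 1 D,
    {P | (1 + ε₀ / √(k : ℝ)) * ‖O i - q‖ < approxDist k (transformed P (O i - q))}

theorem measurableSet_badRotations {D : ℕ} (ε₀ : ℝ) (O : Fin N → EuclideanSpace ℝ (Fin D))
    (q : EuclideanSpace ℝ (Fin D)) : MeasurableSet (badRotations ε₀ O q) :=
  MeasurableSet.iUnion fun i => Finset.measurableSet_biUnion _ fun k _ =>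
    measurableSet_lt measurable_const
      ((measurable_approxDist k).comp (measurable_transformed (O i - q)))

theorem randomOrthogonal_badRotations_le {D : ℕ} {δ' : ℝ} (hD : 0 < D) (hN : 0 < N) (hδ : 0 < δ')
    (hδ1 : δ' ≤ 1) (O : Fin N → EuclideanSpace ℝ (Fin D)) (q : EuclideanSpace ℝ (Fin D)) :
    randomOrthogonal D (badRotations (epsilonParam (1 / 2) D N δ') O q) ≤ ENNReal.ofReal δ' := by
  set ε₀ := epsilonParam (1 / 2) D N δ' with hε₀
  have hDpos : (0 : ℝ) < D := by exact_mod_cast hD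
  have hNpos : (0 : ℝ) < N := by exact_mod_cast hN
  have hD1 : (1 : ℝ) ≤ D := by exact_mod_cast hD
  have hexp : Real.exp (-ε₀ ^ 2 / 2) = δ' / (D * N) := by
    have hL0 := Real.log_nonneg (hD1.trans (le_div_of_pos_of_le_one (D := D) hN hδ hδ1))
    rw [hε₀, neg_div, epsilonParam_half_sq hL0, mul_div_cancel_left₀ _ two_ne_zero, Real.exp_neg,
      Real.exp_log (by positivity), inv_div]
  rw [← ofReal_measureReal]
  refine ENNReal.ofReal_le_ofReal ?_
  calc (randomOrthogonal D).real (badRotations ε₀ O q)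
      ≤ ∑ _i : Fin N, ∑ _k ∈ Finset.Ico 1 D, δ' / (D * N) := by
        refine (measureReal_iUnion_fintype_le _).trans (Finset.sum_le_sum fun i _ => ?_)
        refine (measureReal_biUnion_finset_le _ _).trans (Finset.sum_le_sum fun k hk => ?_)
        rw [Finset.mem_Ico] at hk
        rw [← hexp]
        exact randomOrthogonal_approxDist_gt_le hk.1 hk.2 (Real.sqrt_nonneg _)
    -- Only `D - 1` rounds can err, the last one being exact.
    _ = (D - 1) / D * δ' := by
        simp only [Finset.sum_const, Finset.card_univ, Fintype.card_fin, Nat.card_Ico,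
          nsmul_eq_mul, Nat.cast_sub (show 1 ≤ D from hD), Nat.cast_one]
        field_simp
    _ ≤ 1 * δ' := by
        gcongr
        rw [div_le_one hDpos]
        linarith
    _ = δ' := one_mul _

theorem agreeExceptNegativeCost_of_notMem_badRotations {D : ℕ} {ε₀ : ℝ} (hD : 0 < D)
    (hε : 0 ≤ ε₀) {O : Fin N → EuclideanSpace ℝ (Fin D)} {q : EuclideanSpace ℝ (Fin D)}
    {P : OrthMat D} (hP : P ∉ badRotations ε₀ O q) (A : AKNNProgram N R) :
    AgreeExceptNegativeCost O q (aknnPlusRun ε₀ P O q A) (aknnRun O q A) := by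
  refine AKNNProgram.agreeExceptNegativeCost_run (fun i r => ?_) A
  have hdist : dist (transformed P (O i)) (transformed P q) = dist (O i) q := by
    rw [dist_eq_norm, dist_eq_norm, ← transformed_sub, norm_transformed]
  have hfd : fdScanning (transformed P (O i)) (transformed P q) r = fdScanning (O i) q r := by
    rw [fdScanning, fdScanning, hdist]
  rw [← hfd, ← hdist]
  refine adSampling_of_approxDist_le hD hε (fun k hk hkD => ?_) r
  simp only [badRotations, Set.mem_iUnion, not_exists, Finset.mem_Ico] at hP
  have h := not_lt.mp (mt Set.mem_ofPred.mpr (hP i k ⟨hk, hkD⟩))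
  rwa [transformed_sub, ← dist_eq_norm, ← hdist] at h

end runs

/-- `P` is a random orthogonal matrix on a probability space `Ω`, and the AKNN algorithm `A` may be
any function of `ω : Ω`: it may make random choices of its own, and apart from its DCOs it may work
on the raw vectors or on the vectors transformed by `P`. -/
theorem corollary4p1 :
    ∃ c₀ C : ℝ, 0 < c₀ ∧ 0 < C ∧
      ∀ (D N : ℕ) (δ' : ℝ), 0 < D → 0 < N → 0 < δ' → δ' ≤ 1 →
      ∀ (ε₀ : ℝ), ε₀ = epsilonParam c₀ D N δ' →
      ∀ (Ω : Type*) [MeasurableSpace Ω] (μ : Measure Ω) [IsProbabilityMeasure μ]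
        (P : Ω → OrthMat D), HasLaw P (randomOrthogonal D) μ →
      ∀ (O : Fin N → EuclideanSpace ℝ (Fin D)) (q : EuclideanSpace ℝ (Fin D)),
      -- the expected cost of the DCO on a negative object `i` and a threshold `r`
      (∀ (i : Fin N) (r : ℝ), 0 < r → r < dist (O i) q →
        Integrable (fun ω => ((adSampling ε₀ (transformed (P ω) (O i)) (transformed (P ω) q)
          (ENNReal.ofReal r)).2 : ℝ)) μ ∧
        ∫ ω, ((adSampling ε₀ (transformed (P ω) (O i)) (transformed (P ω) q)
          (ENNReal.ofReal r)).2 : ℝ) ∂μ ≤ C * costBound D N δ' (distanceGap (dist (O i) q) r)) ∧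
      ∀ (R : Type*) (A : Ω → AKNNProgram N R),
        -- AKNN+ fails to return the result of AKNN with probability at most `δ'`
        μ {ω | (aknnPlusRun ε₀ (P ω) O q (A ω)).result ≠ (aknnRun O q (A ω)).result}
          ≤ ENNReal.ofReal δ' ∧
        -- outside an event of probability at most `δ'`, all remaining costs are unchanged, and
        -- no DCO of AKNN+ ever costs more than the `D` dimensions of `FDScanning`
        μ {ω | ¬ AgreeExceptNegativeCost O q (aknnPlusRun ε₀ (P ω) O q (A ω))
            (aknnRun O q (A ω))} ≤ ENNReal.ofReal δ' ∧
        (∀ ω, ∀ e ∈ (aknnPlusRun ε₀ (P ω) O q (A ω)).dcos, e.cost ≤ D) ∧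
        -- the same cost bound for the DCOs made during the run, whose thresholds may depend on
        -- the randomness: some `X` with small expectation dominates the cost of all DCOs on the
        -- object `i` that are negative with distance gap at least `α`
        ∀ (i : Fin N) (α : ℝ), 0 < α → ∃ X : Ω → ℝ, Integrable X μ ∧
          ∫ ω, X ω ∂μ ≤ C * costBound D N δ' α ∧
          ∀ ω, ∀ e ∈ (aknnPlusRun ε₀ (P ω) O q (A ω)).dcos, e.obj = i → 0 < e.threshold →
            e.threshold < ENNReal.ofReal (dist (O i) q) →
            α ≤ distanceGap (dist (O i) q) e.threshold.toReal → (e.cost : ℝ) ≤ X ω := by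
  refine ⟨1 / 2, 100, by norm_num, by norm_num, ?_⟩
  rintro D N δ' hD hN hδ hδ1 ε₀ rfl Ω _ μ _ P hP O q
  set ε₀ := epsilonParam (1 / 2) D N δ' with hε₀
  have hε : 0 ≤ ε₀ := Real.sqrt_nonneg _
  have hcost (i : Fin N) (r α : ℝ) (hr : 0 < r) (hα : 0 < α)
      (hdist : dist (O i) q = (1 + α) * r) :
      Integrable (fun ω => ((adSampling ε₀ (transformed (P ω) (O i)) (transformed (P ω) q)
          (ENNReal.ofReal r)).2 : ℝ)) μ ∧
        ∫ ω, ((adSampling ε₀ (transformed (P ω) (O i)) (transformed (P ω) q)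
          (ENNReal.ofReal r)).2 : ℝ) ∂μ ≤ 100 * costBound D N δ' α := by
    have hint := integrable_adSampling_cost hD ε₀ (ENNReal.ofReal r) (O i) q
    have hle := integral_adSampling_cost_le_costBound hD hN hδ hδ1 hr hα hdist
    rw [← hP.map_eq] at hint hle
    refine ⟨hint.comp_aemeasurable hP.aemeasurable, ?_⟩
    rwa [integral_map hP.aemeasurable hint.aestronglyMeasurable] at hle
  refine ⟨fun i r hr hrd => hcost i r _ hr (div_pos (sub_pos.mpr hrd) hr) ?_, fun R A => ?_⟩
  · rw [distanceGap]
    field_simp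
    ring
  have hbad : μ {ω | ¬ AgreeExceptNegativeCost O q (aknnPlusRun ε₀ (P ω) O q (A ω))
      (aknnRun O q (A ω))} ≤ ENNReal.ofReal δ' := by
    -- The failure event need not be measurable; it is contained in a measurable event about `P`
    -- alone, whatever `A` does.
    calc _ ≤ μ (P ⁻¹' badRotations ε₀ O q) := measure_mono fun ω hω => by
          by_contra h
          exact hω (agreeExceptNegativeCost_of_notMem_badRotations hD hε h (A ω))
      _ = randomOrthogonal D (badRotations ε₀ O q) := by
          rw [← hP.map_eq, Measure.map_apply_of_aemeasurable hP.aemeasurable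
            (measurableSet_badRotations ε₀ O q)]
      _ ≤ _ := randomOrthogonal_badRotations_le hD hN hδ hδ1 O q
  refine ⟨(measure_mono fun ω hω => mt And.left hω).trans hbad, hbad, fun ω e he => ?_,
    fun i α hα => ?_⟩
  · rw [AKNNProgram.cost_eq_of_mem_run _ e he]
    exact adSampling_cost_le hD
  rcases (dist_nonneg : 0 ≤ dist (O i) q).eq_or_lt with h0 | hpos
  -- At distance `0` no threshold makes the object negative.
  · refine ⟨fun _ => 0, integrable_const 0, ?_, fun ω e he hi hr hr' => ?_⟩
    · simpa using costBound_nonneg D N δ' α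
    · rw [← h0] at hr'
      simp at hr'
  -- The threshold `dis / (1 + α)` is the largest with gap at least `α`; the cost there serves as
  -- `X`, by monotonicity in the threshold.
  · have hdist : dist (O i) q = (1 + α) * (dist (O i) q / (1 + α)) := by field_simp
    obtain ⟨hint, hle⟩ := hcost i (dist (O i) q / (1 + α)) α (by positivity) hα hdist
    refine ⟨_, hint, hle, fun ω e he hi hr hr' hgap => ?_⟩
    rw [AKNNProgram.cost_eq_of_mem_run _ e he, hi]
    have hrpos : 0 < e.threshold.toReal := ENNReal.toReal_pos hr.ne' hr'.ne_top
    have hthr : e.threshold ≤ ENNReal.ofReal (dist (O i) q / (1 + α)) := by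
      rw [← ENNReal.ofReal_toReal hr'.ne_top]
      refine ENNReal.ofReal_le_ofReal ?_
      rw [distanceGap, le_div_iff₀ hrpos] at hgap
      rw [le_div_iff₀ (by positivity)]
      linarith
    exact_mod_cast adSampling_cost_mono hD hthr
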